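/- Definitions. Let $n\ge 1$ and $p\ge 1$, $k\ge 0$ be integers. A $[p,n,k]$ complex orthogonal design (COD) is a $p\times n$ matrix $\mathcal O$ whose nonzero entries are of the form $\pm z_i$ or $\pm z_i^*$ ($1\le i\le k$), where $z_1,\dots,z_k$ are complex indeterminates, such that $\mathcal O^H\mathcal O=(|z_1|^2+\cdots+|z_k|^2)I_n$. (For $k=0$ this is a zero matrix.) It is of first type if there are no two rows and two columns whose intersection is, up to the order of the rows and columns, $\begin{pmatrix}\pm z_j&0\\0&\pm z_j^*\end{pmatrix}$ for some $j$. It is atomic if no nonempty proper subset of its rows forms a COD (in the variables of that submatrix). The equivalence operations on CODs are: row permutation, column permutation, conjugation of all instances of a variable, negation of all instances of a variable, (injective) renaming of variables, negation of a row, and negation of a column. Binomial coefficients $\binom{n}{m}$ with $m<0$ or $m>n$ are $0$. The design $\mathcal G_n$ has rows indexed by $\alpha\in\mathbb F_2^{n+1}$ and columns $1,\dots,n$. Its $(\alpha,i)$ entry is $0$ if $\alpha(i)=0$; if $\alpha(i)=1$, it is $(-1)^{\theta(\alpha,i)}z_{\varphi(\alpha,i)}$ when $\alpha(n+1)=0$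 and $(-1)^{\theta(\alpha,i)}z^*_{\varphi(\alpha,i)}$ when $\alpha(n+1)=1$. Here $\varphi(\alpha,i)=\alpha\oplus\alpha(n+1)e\oplus e_i$, where $e_i$ is the $i$-th unit vector and $e=(1,\dots,1)$; and, with $\mathrm{wt}_{i,n+1}(\alpha)$ the number of ones of $\alpha$ in positions $i,\dots,n+1$, $\theta(\alpha,i)=\mathrm{wt}_{i,n+1}(\alpha)+\frac i2$ for even $i$ and $\theta(\alpha,i)=\mathrm{wt}_{i,n+1}(\alpha)+\frac{i-1}2+\alpha(n+1)$ for odd $i$. For an integer $w$, $\mathcal G_n^w$ is the submatrix of $\mathcal G_n$ formed by the rows $\alpha$ of weight $w+1$ with $\alpha(n+1)=0$ and the rows $\alpha$ of weight $n-w+2$ with $\alpha(n+1)=1$. Theorem. Let $\mathcal O$ be an atomic first type COD with parameters $[p,n,k]$, and let $w\ge -1$ be an integer such that some row of $\mathcal O$ has exactly $w+1$ nonzero entries and $n\ne 2w$. Then $$[p,n,k]=\left[\binom n{w-1}+\binom n{w+1},\ n,\ \binom nw\right],$$ and $\mathcal O$ can be transformed into $\mathcal G_n^w$ by equivalence operations,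 none of which is a column negation. -/

import Mathlib

open scoped Matrix

namespace COD

/-- A formal matrix entry over complex indeterminates `z i`, `i : ι`: either `0`, or
`s * z i` (when `conj = false`) or `s * (z i)^*` (when `conj = true`), with a sign `s = ±1`. -/
inductive Entry (ι : Type) : Type
  | zero : Entry ι
  | var (sign : ℤˣ) (conj : Bool) (i : ι) : Entry ι
  deriving DecidableEq

/-- The value of an entry when the indeterminates take the complex values `z`. -/
noncomputable def Entry.eval {ι : Type} (z : ι → ℂ) : Entry ι → ℂ
  | .zero => 0
  | .var s b i => ((s : ℤ) : ℂ) * (if b then star (z i) else z i)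

/-- `O` is a complex orthogonal design whose set of variables is exactly `S`: only variables in `S`
occur, and `Oᴴ O = (∑ i ∈ S, |z i|²) I`. The identity in `z` and `z^*` is required for all
complex values of the variables, which is the same as an identity of polynomials. -/
def IsDesignOn {ρ κ ι : Type} [Fintype ρ] [DecidableEq κ]
    (O : Matrix ρ κ (Entry ι)) (S : Finset ι) : Prop :=
  (∀ r c s b i, O r c = Entry.var s b i → i ∈ S) ∧
  ∀ z : ι → ℂ, (O.map (Entry.eval z))ᴴ * O.map (Entry.eval z) =
    ((∑ i ∈ S, ‖z i‖ ^ 2 : ℝ) : ℂ) • (1 : Matrix κ κ ℂ)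

/-- `O` is a complex orthogonal design with parameters `[p, n, k]`. -/
def IsDesign {p n k : ℕ} (O : Matrix (Fin p) (Fin n) (Entry (Fin k))) : Prop :=
  IsDesignOn O Finset.univ

/-- First type: no two rows and two columns meet, up to their order, in
`(± z_j, 0; 0, ± z_j^*)`. -/
def IsFirstType {p n k : ℕ} (O : Matrix (Fin p) (Fin n) (Entry (Fin k))) : Prop :=
  ¬ ∃ (r r' : Fin p) (c c' : Fin n) (j : Fin k) (s s' : ℤˣ), r ≠ r' ∧ c ≠ c' ∧
    O r c = .var s false j ∧ O r c' = .zero ∧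
    O r' c = .zero ∧ O r' c' = .var s' true j

/-- Atomic: no nonempty proper subset of the rows forms a complex orthogonal design
(in its own set of variables). -/
def IsAtomic {p n k : ℕ} (O : Matrix (Fin p) (Fin n) (Entry (Fin k))) : Prop :=
  ∀ R : Finset (Fin p), R.Nonempty → R ≠ Finset.univ →
    ¬ ∃ S : Finset (Fin k), IsDesignOn (O.submatrix (fun r : R => (r : Fin p)) id) S

/-- The number of nonzero entries in row `r`. -/
def rowWeight {p n k : ℕ} (O : Matrix (Fin p) (Fin n) (Entry (Fin k))) (r : Fin p) : ℕ :=
  (Finset.univ.filter fun c => O r c ≠ .zero).card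

/-- A composite of equivalence operations. Renaming is injective, so that distinct
variables stay distinct; its target may contain indices that occur in no entry. -/
structure Operations (ρ ρ' κ ι ι' : Type) where
  rowPerm : ρ ≃ ρ'
  colPerm : Equiv.Perm κ
  rename : ι ↪ ι'
  instConj : ι → Bool
  instNeg : ι → ℤˣ
  rowNeg : ρ → ℤˣ
  colNeg : κ → ℤˣ

/-- What the operations do to the entry `a` in row `r` and column `c`. -/
def Operations.onEntry {ρ ρ' κ ι ι' : Type} (T : Operations ρ ρ' κ ι ι') (r : ρ) (c : κ) :
    Entry ι → Entry ι'
  | .zero => .zero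
  | .var s b i => .var (T.rowNeg r * T.colNeg c * T.instNeg i * s) (xor b (T.instConj i))
      (T.rename i)

/-- The operations turn `O` into `O'`. -/
def Operations.Transforms {ρ ρ' κ ι ι' : Type} (T : Operations ρ ρ' κ ι ι')
    (O : Matrix ρ κ (Entry ι)) (O' : Matrix ρ' κ (Entry ι')) : Prop :=
  ∀ r c, O' (T.rowPerm r) (T.colPerm c) = T.onEntry r c (O r c)

/-- The binomial coefficient with an integer lower index; it is `0` if the index is negative. -/
def binom (n : ℕ) : ℤ → ℕ
  | Int.ofNat m => n.choose m
  | Int.negSucc _ => 0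

/-- `𝔽₂^{n+1}`. The coordinates `1, …, n+1` are numbered from `0` here. -/
abbrev Vec (n : ℕ) : Type := Fin (n + 1) → ZMod 2

/-- The number of ones in `α`. -/
def wt {n : ℕ} (α : Vec n) : ℕ := (Finset.univ.filter fun l => α l = 1).card

/-- The number of ones in `α` from the coordinate of column `i` to the last coordinate. -/
def wtFrom {n : ℕ} (α : Vec n) (i : Fin n) : ℕ :=
  (Finset.univ.filter fun l => i.castSucc ≤ l ∧ α l = 1).card

/-- The exponent of the sign; the one-based number of column `i` is `(i : ℕ) + 1`. -/
def theta {n : ℕ} (α : Vec n) (i : Fin n) : ℕ :=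
  if Even ((i : ℕ) + 1) then wtFrom α i + ((i : ℕ) + 1) / 2
  else wtFrom α i + (i : ℕ) / 2 + (α (Fin.last n)).val

/-- The variable index `α ⊕ α(n+1) e ⊕ e_i`. -/
def phi {n : ℕ} (α : Vec n) (i : Fin n) : Vec n :=
  α + (fun _ => α (Fin.last n)) + Pi.single i.castSucc 1

/-- The matrix `𝒢_n`. -/
def bigG (n : ℕ) : Matrix (Vec n) (Fin n) (Entry (Vec n)) := fun α i =>
  if α i.castSucc = 0 then .zero
  else .var ((-1) ^ theta α i) (decide (α (Fin.last n) = 1)) (phi α i)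

/-- The rows of `𝒢_n^w`: weight `w+1` and last bit `0`, or weight `n-w+2` and last bit `1`. -/
abbrev GRow (n : ℕ) (w : ℤ) : Type :=
  {α : Vec n // (α (Fin.last n) = 0 ∧ (wt α : ℤ) = w + 1) ∨
    (α (Fin.last n) = 1 ∧ (wt α : ℤ) = n - w + 2)}

/-- The matrix `𝒢_n^w`. -/
def G (n : ℕ) (w : ℤ) : Matrix (GRow n w) (Fin n) (Entry (Vec n)) :=
  (bigG n).submatrix (fun α => α.1) id

end COD

namespace COD

/-! Orthogonality forces every variable to occur exactly once in each column and at most once in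
each row, and any two nonzero entries of a row to complete to a 2×2 block containing both variables
in exchanged positions (`IsDesign.exists_partner`). The first type condition adds that two
occurrences of the same variable agree in conjugation exactly when the row of one vanishes in the
column of the other (`IsFirstType.eq_zero_iff`). So the set of columns in which a variable is
conjugated determines the support of every row containing it. Row weights are constrained to two
values, and atomicity (`IsAtomic.closed_eq_univ`) spreads this over the whole design: after
conjugating some variables, each is conjugated on a `w`-set of columns (`exists_layering`).

Variables sharing a row then have `w`-sets differing by one exchange, so the variables lie over the
Johnson graph of `w`-sets. A row of weight `w+1` gives the `w`-subsets of a fixed `(w+1)`-set, a row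
of the other weight the `w`-sets containing a fixed `(w-1)`-set. These are the two kinds of
triangles, so triangles lift.

Signs are treated at the same time: each variable is doubled by a sign, transported along a row by
comparing `O` with `𝒢_n` (`ratio`, `Edge`). Both matrices satisfy the same sign rule on 2×2 blocks,
so this double is still compatible with edges and triangles. The Johnson graph with triangles filled
in is simply connected (`exists_johnson_section`), hence a section exists. By atomicity its image
meets every variable, so variables correspond bijectively to `w`-sets, and the signs of the section
are the required variable negations (`Layering.exists_signs`). What remains in each row is a
constant sign, removed by row negation, so no column negation is needed. The case `w = -1` is a
single zero row. -/

/-- The entry `e` is a signed, possibly conjugated copy of the variable `j`. -/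
def Entry.HasVar {ι : Type} (e : Entry ι) (j : ι) : Prop := ∃ s b, e = .var s b j

/-! ### Occurrences of variables, 2×2 blocks, and the use of first type and atomicity. -/

section Extraction

variable {p n k : ℕ} {O : Matrix (Fin p) (Fin n) (Entry (Fin k))}

theorem IsDesign.sum_eq (h : IsDesign O) (z : Fin k → ℂ) (c c' : Fin n) :
    ∑ r, star ((O r c).eval z) * (O r c').eval z =
      if c = c' then ((∑ i, ‖z i‖ ^ 2 : ℝ) : ℂ) else 0 := by
  have := congrFun (congrFun (h.2 z) c) c'
  simp only [Matrix.mul_apply, Matrix.conjTranspose_apply, Matrix.map_apply, Matrix.smul_apply,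
    Matrix.one_apply, smul_eq_mul, mul_ite, mul_one, mul_zero] at this
  exact this

theorem Entry.eval_single_of_not {j : Fin k} {e : Entry (Fin k)} (h : ¬ e.HasVar j) (x : ℂ) :
    e.eval (Pi.single j x) = 0 := by
  cases e with
  | zero => rfl
  | var s b i =>
    have : i ≠ j := fun hij => h ⟨s, b, by rw [hij]⟩
    cases b <;> simp [Entry.eval, Pi.single_eq_of_ne this]

theorem sign_cast_mul_self (s : ℤˣ) : ((s : ℤ) : ℂ) * ((s : ℤ) : ℂ) = 1 := by
  rcases Int.units_eq_one_or s with rfl | rfl <;> simp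

theorem Entry.eval_single_of_var (s : ℤˣ) (b : Bool) (j : Fin k) :
    (Entry.var s b j).eval (Pi.single j 1) = ((s : ℤ) : ℂ) := by
  cases b <;> simp [Entry.eval]

/-- At `z_j = 1` and all other variables `0`, the diagonal entry of `Oᴴ O` counts the occurrences of
`j` in the column, and it equals `1`. -/
theorem IsDesign.existsUnique_row (h : IsDesign O) (j : Fin k) (c : Fin n) :
    ∃! r, (O r c).HasVar j := by
  classical
  have h1 := h.sum_eq (Pi.single j 1) c c
  have h2 : ∀ r, star ((O r c).eval (Pi.single j 1)) * (O r c).eval (Pi.single j 1) =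
      if (O r c).HasVar j then (1 : ℂ) else 0 := by
    intro r
    split_ifs with hr
    · obtain ⟨s, b, e⟩ := hr
      rw [e, Entry.eval_single_of_var]
      simp [sign_cast_mul_self]
    · simp [Entry.eval_single_of_not hr]
  have h3 : ∑ i, ‖(Pi.single j (1 : ℂ) : Fin k → ℂ) i‖ ^ 2 = (1 : ℝ) := by
    rw [Finset.sum_eq_single j]
    · simp
    · intro i _ hi
      simp [Pi.single_eq_of_ne hi]
    · simp
  rw [if_pos rfl, h3, Finset.sum_congr rfl fun r _ => h2 r, Finset.sum_boole] at h1
  have h4 : (Finset.univ.filter fun r => (O r c).HasVar j).card = 1 := by exact_mod_cast h1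
  obtain ⟨r, hr⟩ := Finset.card_eq_one.1 h4
  simp only [Finset.ext_iff, Finset.mem_filter, Finset.mem_univ, true_and,
    Finset.mem_singleton] at hr
  exact ⟨r, (hr r).2 rfl, fun y hy => (hr y).1 hy⟩

theorem IsDesign.column_unique (h : IsDesign O) {r : Fin p} {c c' : Fin n} {j : Fin k}
    (hc : (O r c).HasVar j) (hc' : (O r c').HasVar j) : c = c' := by
  by_contra hne
  have h1 := h.sum_eq (Pi.single j 1) c c'
  rw [if_neg hne, Finset.sum_eq_single r] at h1
  · obtain ⟨s, b, e⟩ := hc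
    obtain ⟨s', b', e'⟩ := hc'
    rw [e, e', Entry.eval_single_of_var, Entry.eval_single_of_var] at h1
    simp at h1
  · intro r' _ hr'
    rw [Entry.eval_single_of_not fun h' => hr' ((h.existsUnique_row j c).unique h' hc)]
    simp
  · simp

/-- The product of the two entries must cancel in the inner product of columns `c` and `c'`. The
only row available is the one containing `j` in column `c`. -/
theorem IsDesign.exists_partner (h : IsDesign O) {r : Fin p} {c c' : Fin n} (hcc : c ≠ c')
    {s s' : ℤˣ} {b b' : Bool} {i j : Fin k} (e : O r c = .var s b i) (e' : O r c' = .var s' b' j) :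
    ∃ r' t t', O r' c = .var t (!b') j ∧ O r' c' = .var t' (!b) i ∧ s * s' * (t * t') = -1 := by
  have hij : i ≠ j := by
    rintro rfl
    exact hcc (h.column_unique ⟨_, _, e⟩ ⟨_, _, e'⟩)
  obtain ⟨r', ⟨t, d, f⟩, hr'⟩ := h.existsUnique_row j c
  have hrr : r ≠ r' := by
    rintro rfl
    rw [e] at f
    exact hij (Entry.var.inj f).2.2
  -- With only `z_i` and `z_j` nonzero, column `c` is nonzero only in rows `r` and `r'`, so the
  -- inner product has two terms.
  have key : ∀ z : Fin k → ℂ, (∀ l, l ≠ i → l ≠ j → z l = 0) →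
      star ((O r c).eval z) * (O r c').eval z + star ((O r' c).eval z) * (O r' c').eval z = 0 := by
    intro z hz
    have h1 := h.sum_eq z c c'
    rwa [if_neg hcc, Finset.sum_eq_add r r' hrr] at h1
    · rintro q - ⟨hq, hq'⟩
      have : (O q c).eval z = 0 := by
        cases hE : O q c with
        | zero => rfl
        | var u a l =>
          have h2 : l ≠ i := by
            rintro rfl
            exact hq ((h.existsUnique_row l c).unique ⟨_, _, hE⟩ ⟨_, _, e⟩)
          have h3 : l ≠ j := by
            rintro rfl
            exact hq' (hr' q ⟨_, _, hE⟩)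
          cases a <;> simp [Entry.eval, hz l h2 h3]
      rw [this]
      simp
    · simp
    · simp
  let Z (x y : ℂ) : Fin k → ℂ := fun l => if l = i then x else if l = j then y else 0
  have hZ : ∀ x y, ∀ l, l ≠ i → l ≠ j → Z x y l = 0 := by
    intro x y l h1 h2
    simp [Z, h1, h2]
  have hZi : ∀ x y, Z x y i = x := fun x y => by simp [Z]
  have hZj : ∀ x y, Z x y j = y := fun x y => by simp [Z, hij.symm]
  have hi : (O r' c').HasVar i := by
    have h1 := key (Z 1 1) (hZ 1 1)
    cases hE : O r' c' with
    | zero =>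
      rw [hE, e, e'] at h1
      cases b <;> cases b' <;> simp [Entry.eval, hZi, hZj] at h1
    | var u a l =>
      by_cases hl : l = i
      · exact ⟨u, a, by rw [hl]⟩
      · have hlj : l ≠ j := by
          rintro rfl
          exact hcc (h.column_unique ⟨_, _, f⟩ ⟨_, _, hE⟩)
        rw [hE, e, e'] at h1
        cases b <;> cases b' <;> cases a <;>
          simp [Entry.eval, hZi, hZj, hZ _ _ l hl hlj] at h1
  obtain ⟨t', d', f'⟩ := hi
  -- The value at `(1, 1)` gives the sign rule; putting `I` for one variable at a time detects
  -- conjugation.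
  have h1 := key (Z 1 1) (hZ _ _)
  have h2 := key (Z Complex.I 1) (hZ _ _)
  have h3 := key (Z 1 Complex.I) (hZ _ _)
  rw [e, e', f, f'] at h1 h2 h3
  simp only [Entry.eval, hZi, hZj] at h1 h2 h3
  have hs : ((s : ℤ) : ℂ) * (s' : ℤ) = -((t : ℤ) * (t' : ℤ)) := by
    simpa [add_eq_zero_iff_eq_neg] using h1
  have hs' : ((s : ℤ) * (s' : ℤ)) = -((t : ℤ) * (t' : ℤ)) := by exact_mod_cast hs
  have ht : (((t : ℤ) : ℂ) * (t' : ℤ)) ≠ 0 := by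
    exact_mod_cast (t * t').ne_zero
  have hd' : d' = !b := by
    have h4 : ((t : ℤ) : ℂ) * (t' : ℤ) *
        ((if d' then star Complex.I else Complex.I) -
          star (if b then star Complex.I else Complex.I)) = 0 := by
      simp only [star_mul', star_intCast, star_one, ite_self, mul_one] at h2
      linear_combination h2 - star (if b then star Complex.I else Complex.I) * hs
    have h5 := (mul_eq_zero.1 h4).resolve_left ht
    cases d' <;> cases b <;> first | rfl | norm_num [Complex.ext_iff] at h5
  have hd : d = !b' := by
    have h4 : ((t : ℤ) : ℂ) * (t' : ℤ) *
        (star (if d then star Complex.I else Complex.I) -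
          (if b' then star Complex.I else Complex.I)) = 0 := by
      simp only [star_mul', star_intCast, star_one, ite_self, mul_one] at h3
      linear_combination h3 - (if b' then star Complex.I else Complex.I) * hs
    have h5 := (mul_eq_zero.1 h4).resolve_left ht
    cases d <;> cases b' <;> first | rfl | norm_num [Complex.ext_iff] at h5
  refine ⟨r', t, t', hd ▸ f, hd' ▸ f', ?_⟩
  rcases Int.units_eq_one_or t with rfl | rfl <;> rcases Int.units_eq_one_or t' with rfl | rfl <;>
    rcases Int.units_eq_one_or s with rfl | rfl <;> rcases Int.units_eq_one_or s' with rfl | rfl <;>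
    first | rfl | norm_num at hs'

/-- A nonzero `O r c'` or `O r' c` makes `r` and `r'` partners, with `j` oppositely conjugated in
them. If both vanish, the 2×2 block is diagonal, and first type rules out opposite conjugation. -/
theorem IsFirstType.eq_zero_iff (hf : IsFirstType O) (h : IsDesign O) {r r' : Fin p}
    {c c' : Fin n} (hcc : c ≠ c') {s s' : ℤˣ} {b b' : Bool} {j : Fin k}
    (e : O r c = .var s b j) (e' : O r' c' = .var s' b' j) : O r c' = .zero ↔ b = b' := by
  have hrr : r ≠ r' := by
    rintro rfl
    exact hcc (h.column_unique ⟨_, _, e⟩ ⟨_, _, e'⟩)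
  constructor
  · intro h0
    have h0' : O r' c = .zero := by
      cases hE : O r' c with
      | zero => rfl
      | var u a l =>
        obtain ⟨q, t, t', f, f', -⟩ := h.exists_partner hcc hE e'
        rw [(h.existsUnique_row j c).unique ⟨_, _, f⟩ ⟨_, _, e⟩, h0] at f'
        cases f'
    by_contra hb
    cases b <;> cases b' <;> simp at hb
    · exact hf ⟨r, r', c, c', j, s, s', hrr, hcc, e, h0, h0', e'⟩
    · exact hf ⟨r', r, c', c, j, s', s, hrr.symm, hcc.symm, e', h0', h0, e⟩
  · intro hb
    cases hE : O r c' with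
    | zero => rfl
    | var u a l =>
      obtain ⟨q, t, t', f, f', -⟩ := h.exists_partner hcc e hE
      rw [(h.existsUnique_row j c').unique ⟨_, _, f'⟩ ⟨_, _, e'⟩, e'] at f'
      have := (Entry.var.inj f').2.1
      subst hb
      cases b <;> simp at this

/-- In an atomic design, a nonempty set of variables that is closed under occurring in a common row
contains all variables, and every row contains one of them. -/
theorem IsAtomic.closed_eq_univ (ha : IsAtomic O) (h : IsDesign O) (hn : 0 < n)
    (J : Fin k → Prop) (hJ : ∃ j, J j)
    (hcl : ∀ r c c' i j, (O r c).HasVar i → (O r c').HasVar j → J i → J j) :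
    (∀ j, J j) ∧ ∀ r, ∃ c j, (O r c).HasVar j := by
  classical
  let R : Finset (Fin p) := Finset.univ.filter fun r => ∃ c j, (O r c).HasVar j ∧ J j
  have hR : R = Finset.univ := by
    by_contra hne
    refine ha R ?_ hne ⟨Finset.univ.filter J, ?_, ?_⟩
    · obtain ⟨j, hj⟩ := hJ
      obtain ⟨r, hr, -⟩ := h.existsUnique_row j ⟨0, hn⟩
      exact ⟨r, by simpa [R] using ⟨_, j, hr, hj⟩⟩
    · rintro ⟨r, hr⟩ c s b i e
      obtain ⟨c', j, h1, h2⟩ := (Finset.mem_filter.1 hr).2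
      simpa using hcl r c' c j i h1 ⟨s, b, e⟩ h2
    · intro z
      -- Killing the variables outside `J` annihilates the rows outside `R` and leaves those in `R`
      -- unchanged, so `R` inherits orthogonality.
      let z' : Fin k → ℂ := fun i => if J i then z i else 0
      ext c c'
      have h1 := h.sum_eq z' c c'
      have h2 : ∑ i, ‖z' i‖ ^ 2 = ∑ i ∈ Finset.univ.filter J, ‖z i‖ ^ 2 := by
        rw [Finset.sum_filter]
        refine Finset.sum_congr rfl fun i _ => ?_
        by_cases hi : J i <;> simp [z', hi]
      have hin : ∀ r ∈ R, ∀ c, (O r c).eval z' = (O r c).eval z := by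
        intro r hr c
        obtain ⟨c', j, h1, h2⟩ := (Finset.mem_filter.1 hr).2
        cases hE : O r c with
        | zero => rfl
        | var s b i =>
          have : J i := hcl r c' c j i h1 ⟨s, b, hE⟩ h2
          simp [Entry.eval, z', this]
      have hout : ∀ r, r ∉ R → ∀ c, (O r c).eval z' = 0 := by
        intro r hr c
        cases hE : O r c with
        | zero => rfl
        | var s b i =>
          have : ¬ J i := fun hi => hr (by simpa [R] using ⟨c, i, ⟨s, b, hE⟩, hi⟩)
          cases b <;> simp [Entry.eval, z', this]
      simp only [Matrix.mul_apply, Matrix.conjTranspose_apply, Matrix.map_apply, Matrix.smul_apply,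
        Matrix.one_apply, smul_eq_mul, mul_ite, mul_one, mul_zero, Matrix.submatrix_apply, id]
      rw [← h2, ← h1, ← Finset.sum_subset (Finset.subset_univ R), ← Finset.sum_coe_sort R]
      · exact Finset.sum_congr rfl fun r _ => by rw [hin r r.2, hin r r.2]
      · intro r _ hr
        rw [hout r hr c]
        simp
  have hmem : ∀ r, ∃ c j, (O r c).HasVar j ∧ J j := fun r =>
    (Finset.mem_filter.1 (hR ▸ Finset.mem_univ r : r ∈ R)).2
  refine ⟨fun j => ?_, fun r => ?_⟩
  · obtain ⟨r, hr, -⟩ := h.existsUnique_row j ⟨0, hn⟩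
    obtain ⟨c, i, h1, h2⟩ := hmem r
    exact hcl r c _ i j h1 hr h2
  · obtain ⟨c, j, h1, -⟩ := hmem r
    exact ⟨c, j, h1⟩

end Extraction

/-! ### Simple connectedness of the Johnson graph. -/

section Johnson

variable {α : Type*} [DecidableEq α]

/-- Adjacency in the Johnson graph: `Q` arises from `P` by exchanging one element. -/
def Exchange (P Q : Finset α) : Prop := ∃ a ∈ P, ∃ b, b ∉ P ∧ Q = insert b (P.erase a)

theorem Exchange.symm {P Q : Finset α} (h : Exchange P Q) : Exchange Q P := by
  obtain ⟨a, ha, b, hb, rfl⟩ := h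
  have hab : a ≠ b := fun h => hb (h ▸ ha)
  refine ⟨b, by simp, a, by simp [hab], ?_⟩
  ext x
  simp only [Finset.mem_insert, Finset.mem_erase]
  grind

theorem Exchange.card_eq {P Q : Finset α} (h : Exchange P Q) : Q.card = P.card := by
  obtain ⟨a, ha, b, hb, rfl⟩ := h
  rw [Finset.card_insert_of_notMem (by simp [hb]), Finset.card_erase_add_one ha]

/-- One step from `P` towards `P₀`. -/
def Toward (P₀ P Q : Finset α) : Prop :=
  ∃ a ∈ P \ P₀, ∃ b ∈ P₀ \ P, Q = insert b (P.erase a)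

theorem Toward.exchange {P₀ P Q : Finset α} (h : Toward P₀ P Q) : Exchange P Q := by
  obtain ⟨a, ha, b, hb, rfl⟩ := h
  exact ⟨a, (Finset.mem_sdiff.1 ha).1, b, (Finset.mem_sdiff.1 hb).2, rfl⟩

theorem Toward.card_sdiff {P₀ P Q : Finset α} (h : Toward P₀ P Q) :
    (Q \ P₀).card + 1 = (P \ P₀).card := by
  obtain ⟨a, ha, b, hb, rfl⟩ := h
  have : insert b (P.erase a) \ P₀ = (P \ P₀).erase a := by
    ext x
    simp only [Finset.mem_insert, Finset.mem_erase, Finset.mem_sdiff] at *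
    grind
  rw [this, Finset.card_erase_add_one ha]

theorem exists_toward {P₀ P : Finset α} (hc : P.card = P₀.card) (h : P ≠ P₀) :
    ∃ Q, Toward P₀ P Q := by
  have h1 : (P \ P₀).card = (P₀ \ P).card := by
    have := Finset.card_sdiff_add_card_inter P P₀
    have := Finset.card_sdiff_add_card_inter P₀ P
    rw [Finset.inter_comm] at this
    omega
  have h2 : (P \ P₀).Nonempty := by
    rw [Finset.sdiff_nonempty]
    exact fun hs => h (Finset.eq_of_subset_of_card_le hs hc.ge)
  obtain ⟨a, ha⟩ := h2
  obtain ⟨b, hb⟩ : (P₀ \ P).Nonempty := by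
    rw [← Finset.card_pos, ← h1]
    exact Finset.card_pos.2 ⟨a, ha⟩
  exact ⟨_, a, ha, b, hb, rfl⟩

/-- Makes the lift at a set independent of the lower neighbour used: `M` drops the element dropped
by `Q` and gains the one gained by `Q'`. -/
theorem Toward.middle {P₀ P Q Q' : Finset α} (h : Toward P₀ P Q) (h' : Toward P₀ P Q') :
    ∃ M, Toward P₀ P M ∧ (M = Q ∨ Exchange M Q) ∧ (M = Q' ∨ Exchange M Q') := by
  obtain ⟨a, ha, b, hb, rfl⟩ := h
  obtain ⟨a', ha', b', hb', rfl⟩ := h'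
  refine ⟨insert b' (P.erase a), ⟨a, ha, b', hb', rfl⟩, ?_, ?_⟩
  · by_cases hbb : b' = b
    · exact Or.inl (by rw [hbb])
    · refine Or.inr ⟨b', by simp, b, ?_, ?_⟩
      · simp only [Finset.mem_insert, Finset.mem_erase, Finset.mem_sdiff] at *
        grind
      · ext x
        simp only [Finset.mem_insert, Finset.mem_erase, Finset.mem_sdiff] at *
        grind
  · by_cases haa : a = a'
    · exact Or.inl (by rw [haa])
    · refine Or.inr ⟨a', ?_, a, ?_, ?_⟩
      · simp only [Finset.mem_insert, Finset.mem_erase, Finset.mem_sdiff] at *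
        grind
      · simp only [Finset.mem_insert, Finset.mem_erase, Finset.mem_sdiff] at *
        grind
      · ext x
        simp only [Finset.mem_insert, Finset.mem_erase, Finset.mem_sdiff] at *
        grind

/-- An edge between sets at equal distance from `P₀` spans a triangle with a closer set, which is
what extends the section across such edges. -/
theorem Exchange.toward_or {P₀ P P' : Finset α} (h : Exchange P P') (hc : P.card = P₀.card)
    (hne : P ≠ P₀) : Toward P₀ P P' ∨ Toward P₀ P' P ∨ ∃ Q, Toward P₀ P Q ∧ Toward P₀ P' Q := by
  obtain ⟨Q, a₁, ha₁, b₁, hb₁, rfl⟩ := exists_toward hc hne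
  obtain ⟨a, ha, b, hb, rfl⟩ := h
  by_cases hA : a ∈ P₀ <;> by_cases hB : b ∈ P₀
  · refine Or.inr (Or.inr ⟨insert b (P.erase a₁), ⟨a₁, ha₁, b, by simp [hb, hB], rfl⟩,
      a₁, ?_, a, ?_, ?_⟩)
    · simp only [Finset.mem_insert, Finset.mem_erase, Finset.mem_sdiff] at *
      grind
    · simp only [Finset.mem_insert, Finset.mem_erase, Finset.mem_sdiff] at *
      grind
    · ext x
      simp only [Finset.mem_insert, Finset.mem_erase, Finset.mem_sdiff] at *
      grind
  · refine Or.inr (Or.inl ⟨b, by simp [hB], a, ?_, ?_⟩)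
    · simp only [Finset.mem_insert, Finset.mem_erase, Finset.mem_sdiff] at *
      grind
    · ext x
      simp only [Finset.mem_insert, Finset.mem_erase, Finset.mem_sdiff] at *
      grind
  · exact Or.inl ⟨a, by simp [ha, hA], b, by simp [hb, hB], rfl⟩
  · refine Or.inr (Or.inr ⟨insert b₁ (P.erase a), ⟨a, by simp [ha, hA], b₁, hb₁, rfl⟩,
      b, by simp [hB], b₁, ?_, ?_⟩)
    · simp only [Finset.mem_insert, Finset.mem_erase, Finset.mem_sdiff] at *
      grind
    · ext x
      simp only [Finset.mem_insert, Finset.mem_erase, Finset.mem_sdiff] at *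
      grind

/-- Simple connectedness of the Johnson graph with its triangles filled in: a covering in which all
triangles lift has a section through every point. -/
theorem exists_johnson_section {X : Type*} (π : X → Finset α) (E : X → X → Prop)
    (hsymm : ∀ x y, E x y → E y x)
    (hlift : ∀ x Q, Exchange (π x) Q → ∃ y, E x y ∧ π y = Q)
    (htri : ∀ x y z, E x y → E y z → Exchange (π x) (π z) → E x z)
    (x₀ : X) :
    ∃ σ : Finset α → X, σ (π x₀) = x₀ ∧ (∀ P, P.card = (π x₀).card → π (σ P) = P) ∧
      ∀ P Q, P.card = (π x₀).card → Exchange P Q → E (σ P) (σ Q) := by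
  classical
  have : Nonempty X := ⟨x₀⟩
  set P₀ := π x₀ with hP₀
  have hball : ∀ d : ℕ, ∃ σ : Finset α → X, σ P₀ = x₀ ∧
      (∀ P, P.card = P₀.card → (P \ P₀).card ≤ d → π (σ P) = P) ∧
      ∀ P Q, P.card = P₀.card → (P \ P₀).card ≤ d → (Q \ P₀).card ≤ d → Exchange P Q →
        E (σ P) (σ Q) := by
    intro d
    induction d with
    | zero =>
      have h0 : ∀ P : Finset α, P.card = P₀.card → (P \ P₀).card ≤ 0 → P = P₀ := fun P hc h =>
        Finset.eq_of_subset_of_card_le (Finset.sdiff_eq_empty_iff_subset.1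
          (Finset.card_eq_zero.1 (Nat.le_zero.1 h))) hc.ge
      refine ⟨fun _ => x₀, rfl, fun P hc h => (h0 P hc h).symm, fun P Q hc hP hQ h => ?_⟩
      exfalso
      have h1 := h0 P hc hP
      have h2 := h0 Q (h.card_eq.trans hc) hQ
      obtain ⟨a, ha, b, hb, e⟩ := h
      rw [h2, ← h1] at e
      exact hb (e ▸ Finset.mem_insert_self b _)
    | succ d ih =>
      obtain ⟨σ, hσ0, hσπ, hσE⟩ := ih
      -- the value at a set at distance `d + 1`
      have hext : ∀ P, P.card = P₀.card → (P \ P₀).card = d + 1 →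
          ∃ x, π x = P ∧ ∀ Q, Toward P₀ P Q → E x (σ Q) := by
        intro P hc hP
        have hne : P ≠ P₀ := by
          rintro rfl
          simp at hP
        have hQ : ∀ Q, Toward P₀ P Q → Q.card = P₀.card ∧ (Q \ P₀).card ≤ d := fun Q h =>
          ⟨h.exchange.card_eq.trans hc, by have := h.card_sdiff; omega⟩
        obtain ⟨Q, hPQ⟩ := exists_toward hc hne
        obtain ⟨hQc, hQd⟩ := hQ Q hPQ
        -- Lift from one lower neighbour `Q`; the triangles through `M` carry the edge over to every
        -- other lower neighbour.
        obtain ⟨x, hx, hxP⟩ := hlift (σ Q) P (by rw [hσπ Q hQc hQd]; exact hPQ.exchange.symm)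
        refine ⟨x, hxP, fun Q' hPQ' => ?_⟩
        have hstep : ∀ M N, Toward P₀ P M → Toward P₀ P N → (M = N ∨ Exchange M N) →
            E x (σ M) → E x (σ N) := by
          intro M N hM hN h hxM
          rcases h with rfl | h
          · exact hxM
          · refine htri x (σ M) (σ N) hxM
              (hσE M N (hQ M hM).1 (hQ M hM).2 (hQ N hN).2 h) ?_
            rw [hxP, hσπ N (hQ N hN).1 (hQ N hN).2]
            exact hN.exchange
        obtain ⟨M, hM, h1, h2⟩ := hPQ.middle hPQ'
        refine hstep M Q' hM hPQ' h2 (hstep Q M hPQ hM ?_ (hsymm _ _ hx))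
        exact h1.imp Eq.symm Exchange.symm
      choose! f hfπ hfE using hext
      refine ⟨fun P => if (P \ P₀).card = d + 1 then f P else σ P, by simp [hσ0], ?_, ?_⟩
      · intro P hc hP
        dsimp only
        split_ifs with h
        · exact hfπ P hc h
        · exact hσπ P hc (by omega)
      · intro P Q hc hP hQ h
        have hQc := h.card_eq.trans hc
        have hdown : ∀ P Q, P.card = P₀.card → (P \ P₀).card = d + 1 → Toward P₀ P Q →
            E (f P) (if (Q \ P₀).card = d + 1 then f Q else σ Q) := by
          intro P Q hc hP h
          rw [if_neg (by have := h.card_sdiff; omega)]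
          exact hfE P hc hP Q h
        by_cases h1 : (P \ P₀).card = d + 1 <;> by_cases h2 : (Q \ P₀).card = d + 1
        · have hne : P ≠ P₀ := by
            rintro rfl
            simp at h1
          simp only [h1, h2, if_true]
          rcases h.toward_or hc hne with h3 | h3 | ⟨R, h3, h4⟩
          · have := h3.card_sdiff
            omega
          · have := h3.card_sdiff
            omega
          · refine htri _ _ _ (hfE P hc h1 R h3) (hsymm _ _ (hfE Q hQc h2 R h4)) ?_
            rw [hfπ P hc h1, hfπ Q hQc h2]
            exact h
        · have hne : P ≠ P₀ := by
            rintro rfl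
            simp at h1
          simp only [h1, if_true]
          rcases h.toward_or hc hne with h3 | h3 | ⟨R, h3, h4⟩
          · exact hdown P Q hc h1 h3
          · have := h3.card_sdiff
            omega
          · have := h3.card_sdiff
            have := h4.card_sdiff
            omega
        · have hne : Q ≠ P₀ := by
            rintro rfl
            simp at h2
          simp only [h2, if_true]
          rcases h.symm.toward_or hQc hne with h3 | h3 | ⟨R, h3, h4⟩
          · exact hsymm _ _ (hdown Q P hQc h2 h3)
          · have := h3.card_sdiff
            omega
          · have := h3.card_sdiff
            have := h4.card_sdiff
            omega
        · simp only [h1, h2, if_false]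
          exact hσE P Q hc (by omega) (by omega) h
  -- Sets of the same size as `P₀` are at distance at most `P₀.card`.
  obtain ⟨σ, h0, h1, h2⟩ := hball P₀.card
  have hle : ∀ P : Finset α, P.card = P₀.card → (P \ P₀).card ≤ P₀.card := fun P hc =>
    (Finset.card_le_card Finset.sdiff_subset).trans hc.le
  exact ⟨σ, h0, fun P hc => h1 P hc (hle P hc),
    fun P Q hc h => h2 P Q hc (hle P hc) (hle Q (h.card_eq.trans hc)) h⟩

end Johnson

/-! ### Supports, variable indices, signs and row count of the target design. -/

section Target

variable {n : ℕ}

/-- The vector with support `S` on the first `n` coordinates and last coordinate `t`. -/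
def vec (S : Finset (Fin n)) (t : ZMod 2) : Vec n :=
  Fin.snoc (α := fun _ => ZMod 2) (fun i => if i ∈ S then 1 else 0) t

@[simp] theorem vec_castSucc (S : Finset (Fin n)) (t : ZMod 2) (i : Fin n) :
    vec S t i.castSucc = if i ∈ S then 1 else 0 := by
  simp [vec]

@[simp] theorem vec_last (S : Finset (Fin n)) (t : ZMod 2) : vec S t (Fin.last n) = t := by
  simp [vec]

theorem vec_injective {S S' : Finset (Fin n)} {t t' : ZMod 2} (h : vec S t = vec S' t') :
    S = S' ∧ t = t' := by
  refine ⟨?_, by simpa using congrFun h (Fin.last n)⟩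
  ext i
  have := congrFun h i.castSucc
  simp only [vec_castSucc] at this
  by_cases h1 : i ∈ S <;> by_cases h2 : i ∈ S' <;> simp [h1, h2] at this ⊢

theorem zmod_two_eq_zero_or_one (x : ZMod 2) : x = 0 ∨ x = 1 := by
  revert x
  decide

theorem vec_eta (α : Vec n) :
    vec (Finset.univ.filter fun i => α i.castSucc = 1) (α (Fin.last n)) = α := by
  ext i
  refine Fin.lastCases ?_ (fun i => ?_) i
  · simp
  · rcases zmod_two_eq_zero_or_one (α i.castSucc) with h | h <;> simp [h]

theorem card_filter_vec (S : Finset (Fin n)) (t : ZMod 2) (q : Fin (n + 1) → Prop)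
    [DecidablePred q] (hq : q (Fin.last n)) :
    (Finset.univ.filter fun l => q l ∧ vec S t l = 1).card =
      (S.filter fun i => q i.castSucc).card + t.val := by
  rw [Finset.card_filter, Fin.sum_univ_castSucc, ← Finset.card_filter]
  congr 1
  · congr 1
    ext i
    simp [and_comm]
  · rcases zmod_two_eq_zero_or_one t with rfl | rfl
    · simp
    · simp [hq, ZMod.val_one]

theorem wt_vec (S : Finset (Fin n)) (t : ZMod 2) : wt (vec S t) = S.card + t.val := by
  simpa [wt] using card_filter_vec S t (fun _ => True) trivial

theorem wtFrom_vec (S : Finset (Fin n)) (t : ZMod 2) (i : Fin n) :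
    wtFrom (vec S t) i = (S.filter fun l => i ≤ l).card + t.val := by
  simpa [wtFrom] using card_filter_vec S t (fun l => i.castSucc ≤ l) (Fin.le_last _)

theorem phi_vec_zero {S : Finset (Fin n)} {i : Fin n} (hi : i ∈ S) :
    phi (vec S 0) i = vec (S.erase i) 0 := by
  ext l
  refine Fin.lastCases ?_ (fun l => ?_) l
  · simp [phi, (Fin.castSucc_lt_last i).ne']
  · by_cases h : l = i
    · subst h
      simp only [phi, Pi.add_apply, vec_castSucc, vec_last, Pi.single_eq_same, hi, if_true]
      simp
      rfl
    · simp [phi, h]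

theorem phi_vec_one {S : Finset (Fin n)} {i : Fin n} (hi : i ∈ S) :
    phi (vec S 1) i = vec (insert i Sᶜ) 0 := by
  have h2 : (1 + 1 : ZMod 2) = 0 := rfl
  ext l
  refine Fin.lastCases ?_ (fun l => ?_) l
  · simp [phi, (Fin.castSucc_lt_last i).ne', h2]
  · by_cases h : l = i
    · subst h
      simp [phi, hi, h2]
    · by_cases hl : l ∈ S <;> simp [phi, h, hl, h2]

theorem bigG_vec_of_notMem {S : Finset (Fin n)} {t : ZMod 2} {i : Fin n} (hi : i ∉ S) :
    bigG n (vec S t) i = .zero := by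
  simp [bigG, hi]

theorem bigG_vec_of_mem {S : Finset (Fin n)} {t : ZMod 2} {i : Fin n} (hi : i ∈ S) :
    bigG n (vec S t) i =
      .var ((-1) ^ theta (vec S t) i) (decide (t = 1)) (phi (vec S t) i) := by
  simp [bigG, hi]

/-- The two supports cover all columns and overlap exactly in `{i, i'}`. -/
theorem card_filter_le_add {S S' : Finset (Fin n)} {i i' : Fin n} (hi : i ∈ S) (hi' : i' ∈ S)
    (hS' : S' = insert i (insert i' Sᶜ)) (l : Fin n) :
    (S.filter fun x => l ≤ x).card + (S'.filter fun x => l ≤ x).card =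
      (n - l) + (({i, i'} : Finset (Fin n)).filter fun x => l ≤ x).card := by
  rw [← Finset.card_union_add_card_inter, ← Finset.filter_union, ← Finset.filter_inter_distrib]
  have h1 : S ∪ S' = Finset.univ := by
    subst hS'
    ext x
    simp only [Finset.mem_union, Finset.mem_insert, Finset.mem_compl, Finset.mem_univ, iff_true]
    tauto
  have h2 : S ∩ S' = {i, i'} := by
    subst hS'
    ext x
    simp only [Finset.mem_inter, Finset.mem_insert, Finset.mem_compl, Finset.mem_singleton]
    grind
  rw [h1, h2, Finset.filter_le_eq_Ici, Fin.card_Ici]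

theorem theta_parity_of_lt {S S' : Finset (Fin n)} {i i' : Fin n} (hi : i ∈ S) (hi' : i' ∈ S)
    (hlt : i < i') (hS' : S' = insert i (insert i' Sᶜ)) :
    Odd (theta (vec S 0) i + theta (vec S 0) i' +
      (theta (vec S' 1) i + theta (vec S' 1) i')) := by
  have h1 := card_filter_le_add hi hi' hS' i
  have h2 := card_filter_le_add hi hi' hS' i'
  have e1 : (({i, i'} : Finset (Fin n)).filter fun x => i ≤ x).card = 2 := by
    rw [Finset.filter_true_of_mem, Finset.card_pair hlt.ne]
    simp [hlt.le]
  have e2 : (({i, i'} : Finset (Fin n)).filter fun x => i' ≤ x).card = 1 := by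
    rw [Finset.card_eq_one]
    refine ⟨i', ?_⟩
    ext x
    simp only [Finset.mem_filter, Finset.mem_insert, Finset.mem_singleton]
    constructor
    · rintro ⟨rfl | rfl, h⟩
      · exact absurd h (not_le.2 hlt)
      · rfl
    · rintro rfl
      exact ⟨Or.inr rfl, le_rfl⟩
  rw [e1] at h1
  rw [e2] at h2
  have hin := i.2
  have hin' := i'.2
  -- The halved column numbers occur twice and cancel modulo 2. The extra last bit in odd-numbered
  -- columns compensates the parity of the column number coming from `n - i`.
  simp only [theta, wtFrom_vec, vec_last, ZMod.val_zero, ZMod.val_one, Nat.even_iff, Nat.odd_iff]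
  split_ifs <;> omega

theorem theta_sign {S S' : Finset (Fin n)} {i i' : Fin n} (hi : i ∈ S) (hi' : i' ∈ S)
    (hne : i ≠ i') (hS' : S' = insert i (insert i' Sᶜ)) :
    ((-1) ^ theta (vec S 0) i * (-1) ^ theta (vec S 0) i' *
      ((-1) ^ theta (vec S' 1) i * (-1) ^ theta (vec S' 1) i') : ℤˣ) = -1 := by
  rw [← pow_add, ← pow_add, ← pow_add]
  apply Odd.neg_one_pow
  rcases lt_or_gt_of_ne hne with h | h
  · exact theta_parity_of_lt hi hi' h hS'
  · have := theta_parity_of_lt hi' hi h (hS'.trans (Finset.insert_comm _ _ _))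
    convert this using 1
    omega

theorem card_vec_wt (t : ZMod 2) (m : ℕ) :
    Fintype.card {α : Vec n // α (Fin.last n) = t ∧ wt α = m + t.val} = n.choose m := by
  rw [Fintype.card_subtype]
  conv_rhs => rw [← Fintype.card_fin n, ← Finset.card_univ, ← Finset.card_powersetCard]
  symm
  refine Finset.card_bij (fun S _ => vec S t) ?_ ?_ ?_
  · intro S hS
    simp [wt_vec, (Finset.mem_powersetCard.1 hS).2]
  · intro S _ S' _ h
    exact (vec_injective h).1
  · intro α hα
    simp only [Finset.mem_filter, Finset.mem_univ, true_and] at hα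
    refine ⟨Finset.univ.filter fun i => α i.castSucc = 1, ?_, ?_⟩
    · have := wt_vec (Finset.univ.filter fun i => α i.castSucc = 1) (α (Fin.last n))
      rw [vec_eta, hα.2, hα.1] at this
      simp only [Finset.mem_powersetCard, Finset.subset_univ, true_and]
      omega
    · rw [← hα.1, vec_eta]

theorem card_GRow (w : ℤ) (hw : -1 ≤ w) (hwn : w ≤ n) :
    Fintype.card (GRow n w) = binom n (w - 1) + binom n (w + 1) := by
  rw [Fintype.card_subtype_or_disjoint]
  swap
  · rw [Pi.disjoint_iff]
    intro α
    rw [Prop.disjoint_iff]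
    rintro ⟨⟨h, -⟩, h', -⟩
    rw [h] at h'
    exact absurd h' (by decide)
  obtain ⟨m, hm⟩ := Int.eq_ofNat_of_zero_le (show 0 ≤ w + 1 by omega)
  obtain ⟨q, hq⟩ := Int.eq_ofNat_of_zero_le (show 0 ≤ (n : ℤ) - w + 1 by omega)
  have h1 : Fintype.card {α : Vec n // α (Fin.last n) = 0 ∧ (wt α : ℤ) = w + 1} = n.choose m := by
    rw [← card_vec_wt 0 m]
    refine Fintype.card_congr (Equiv.subtypeEquivRight fun α => ?_)
    rw [hm, ZMod.val_zero]
    norm_cast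
  have h2 : Fintype.card {α : Vec n // α (Fin.last n) = 1 ∧ (wt α : ℤ) = n - w + 2} =
      n.choose q := by
    rw [← card_vec_wt 1 q]
    refine Fintype.card_congr (Equiv.subtypeEquivRight fun α => ?_)
    rw [show (n : ℤ) - w + 2 = ((q + 1 : ℕ) : ℤ) by push_cast; omega, ZMod.val_one]
    norm_cast
  rw [h1, h2, hm, add_comm]
  congr 1
  -- Rows with last bit `1` have `n - w + 1` ones before it: impossible if `w < 1`, and otherwise
  -- counted by symmetry of binomials.
  rcases lt_or_ge (w - 1) 0 with h | h
  · obtain ⟨l, hl⟩ := Int.eq_negSucc_of_lt_zero h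
    rw [hl, binom, Nat.choose_eq_zero_of_lt (by omega)]
  · obtain ⟨l, hl⟩ := Int.eq_ofNat_of_zero_le h
    rw [hl]
    change _ = n.choose l
    rw [← Nat.choose_symm (show l ≤ n by omega)]
    congr 1
    omega

end Target

/-! ### Labelling variables by `w`-sets, and the signed covering of the Johnson graph. -/

section Structure

variable {p n k : ℕ} {O : Matrix (Fin p) (Fin n) (Entry (Fin k))} {w : ℕ}

/-- The columns in which row `r` is nonzero. -/
def support (O : Matrix (Fin p) (Fin n) (Entry (Fin k))) (r : Fin p) : Finset (Fin n) :=
  Finset.univ.filter fun c => O r c ≠ .zero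

theorem mem_support {r : Fin p} {c : Fin n} : c ∈ support O r ↔ ∃ j, (O r c).HasVar j := by
  simp only [support, Finset.mem_filter, Finset.mem_univ, true_and]
  cases h : O r c with
  | zero => simp [Entry.HasVar]
  | var s b i => simp [Entry.HasVar]

/-- A labelling of the variables by `w`-subsets of the columns: up to conjugation of all its
instances, the variable `j` is conjugated exactly in the columns of `set j`. -/
structure Layering (O : Matrix (Fin p) (Fin n) (Entry (Fin k))) (w : ℕ) where
  set : Fin k → Finset (Fin n)
  conj : Fin k → Bool
  card_set : ∀ j, (set j).card = w
  conj_eq : ∀ r c s b j, O r c = .var s b j → b = xor (decide (c ∈ set j)) (conj j)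
  support_eq : ∀ r c j, (O r c).HasVar j →
    support O r = insert c (if c ∈ set j then (set j)ᶜ else set j)

/-- A variable conjugated on a set of size `m` lies only in rows of weight `m + 1` or `n - m + 1`, a
pair unchanged by passing to the complement. Hence variables in a common row have the same size up
to complement, and atomicity propagates the value `w` from `r₀`. -/
theorem exists_layering (h : IsDesign O) (hf : IsFirstType O) (ha : IsAtomic O) (hn : 0 < n)
    {r₀ : Fin p} (hr₀ : rowWeight O r₀ = w + 1) :
    Nonempty (Layering O w) ∧ ∀ r, ∃ c j, (O r c).HasVar j := by
  have hcol : ∀ j c, ∃ r s b, O r c = .var s b j := fun j c =>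
    (h.existsUnique_row j c).exists
  choose row sgn bit hrow using hcol
  have hbit : ∀ r c s b j, O r c = .var s b j → b = bit j c := by
    intro r c s b j e
    have h1 := (h.existsUnique_row j c).unique ⟨_, _, e⟩ ⟨_, _, hrow j c⟩
    rw [h1, hrow j c] at e
    exact (Entry.var.inj e).2.1.symm
  let T : Fin k → Finset (Fin n) := fun j => Finset.univ.filter fun c => bit j c = true
  -- A variable is conjugated throughout unless its conjugated set already has size `w`.
  let cj : Fin k → Bool := fun j => decide ((T j).card ≠ w)
  let P : Fin k → Finset (Fin n) := fun j => Finset.univ.filter fun c => bit j c = !cj j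
  have hP : ∀ j c, c ∈ P j ↔ bit j c = !cj j := fun j c => by simp [P]
  have hsupp : ∀ r c j, (O r c).HasVar j →
      support O r = insert c (if c ∈ P j then (P j)ᶜ else P j) := by
    rintro r c j ⟨s, b, e⟩
    ext c'
    by_cases hcc : c' = c
    · subst hcc
      simp only [Finset.mem_insert_self, iff_true]
      exact mem_support.2 ⟨j, _, _, e⟩
    · have h1 := hf.eq_zero_iff h (Ne.symm hcc) e (hrow j c')
      rw [hbit r c s b j e] at h1
      have h2 : c' ∈ support O r ↔ ¬ bit j c = bit j c' := by
        rw [← h1]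
        simp [support]
      rw [h2, Finset.mem_insert, or_iff_right hcc]
      split_ifs with h3
      · rw [Finset.mem_compl, hP, not_congr]
        rw [hP] at h3
        rw [h3, eq_comm]
      · rw [hP] at h3 ⊢
        generalize bit j c = x at *
        generalize bit j c' = y at *
        generalize cj j = z at *
        clear * - h3
        revert x y z
        decide
  have hcard : ∀ j, (P j).card = w ∨ (P j).card + w = n → (P j).card = w := by
    intro j hj
    by_cases hT : (T j).card = w
    · have : P j = T j := by
        ext c
        simp [hP, T, cj, hT]
      rw [this, hT]
    · have : P j = (T j)ᶜ := by
        ext c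
        simp [hP, T, cj, hT]
      rcases hj with hj | hj
      · exact hj
      · have h1 := Finset.card_add_card_compl (T j)
        rw [← this, Fintype.card_fin] at h1
        omega
  have hsc : ∀ r c j, (O r c).HasVar j →
      (support O r).card = (P j).card + 1 ∨ (support O r).card + (P j).card = n + 1 := by
    intro r c j hj
    have h1 := hsupp r c j hj
    split_ifs at h1 with h2
    · have h3 := Finset.card_add_card_compl (P j)
      rw [Fintype.card_fin] at h3
      rw [h1, Finset.card_insert_of_notMem (by simpa using h2)]
      omega
    · rw [h1, Finset.card_insert_of_notMem h2]
      exact Or.inl rfl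
  have hle : ∀ j, (P j).card ≤ n := fun j => by
    simpa using Finset.card_le_univ (P j)
  obtain ⟨hall, hne⟩ := ha.closed_eq_univ h hn (fun j => (P j).card = w) (by
      have h1 : (support O r₀).card = w + 1 := hr₀
      obtain ⟨c, hc⟩ : (support O r₀).Nonempty := by
        rw [← Finset.card_pos]
        omega
      obtain ⟨j, hj⟩ := mem_support.1 hc
      refine ⟨j, hcard j ?_⟩
      have := hsc r₀ c j hj
      omega) (by
      intro r c c' i j hi hj hw
      apply hcard
      have h1 := hsc r c i hi
      have h2 := hsc r c' j hj
      have := hle i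
      have := hle j
      omega)
  refine ⟨⟨P, cj, hall, ?_, hsupp⟩, hne⟩
  intro r c s b j e
  rw [hbit r c s b j e]
  by_cases h1 : c ∈ P j
  · rw [decide_eq_true h1, (hP j c).1 h1]
    simp
  · rw [decide_eq_false h1]
    rw [hP] at h1
    simpa using h1

/-- The last coordinate of the row of `𝒢_n^w` that corresponds to row `r`. -/
def lastBit (O : Matrix (Fin p) (Fin n) (Entry (Fin k))) (w : ℕ) (r : Fin p) : ZMod 2 :=
  if (support O r).card = w + 1 then 0 else 1

/-- The row of `𝒢_n^w` that corresponds to row `r`. -/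
def rowVec (O : Matrix (Fin p) (Fin n) (Entry (Fin k))) (w : ℕ) (r : Fin p) : Vec n :=
  vec (support O r) (lastBit O w r)

/-- The sign of an entry; it is `1` for the zero entry. -/
def Entry.sgn {ι : Type} : Entry ι → ℤˣ
  | .zero => 1
  | .var s _ _ => s

/-- The sign of an entry relative to that of the corresponding entry of `𝒢_n^w`. -/
def ratio (O : Matrix (Fin p) (Fin n) (Entry (Fin k))) (w : ℕ) (r : Fin p) (c : Fin n) : ℤˣ :=
  (O r c).sgn * (-1) ^ theta (rowVec O w r) c

namespace Layering

variable (L : Layering O w)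

theorem le (L : Layering O w) (j : Fin k) : w ≤ n := by
  rw [← L.card_set j]
  simpa using Finset.card_le_univ (L.set j)

theorem support_of_notMem {r : Fin p} {c : Fin n} {j : Fin k} (hj : (O r c).HasVar j)
    (hc : c ∉ L.set j) : support O r = insert c (L.set j) := by
  rw [L.support_eq r c j hj, if_neg hc]

theorem support_of_mem {r : Fin p} {c : Fin n} {j : Fin k} (hj : (O r c).HasVar j)
    (hc : c ∈ L.set j) : support O r = insert c (L.set j)ᶜ := by
  rw [L.support_eq r c j hj, if_pos hc]

theorem card_support_of_notMem {r : Fin p} {c : Fin n} {j : Fin k} (hj : (O r c).HasVar j)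
    (hc : c ∉ L.set j) : (support O r).card = w + 1 := by
  rw [L.support_of_notMem hj hc, Finset.card_insert_of_notMem hc, L.card_set]

theorem card_support_of_mem {r : Fin p} {c : Fin n} {j : Fin k} (hj : (O r c).HasVar j)
    (hc : c ∈ L.set j) : (support O r).card + w = n + 1 := by
  have := Finset.card_add_card_compl (L.set j)
  rw [Fintype.card_fin, L.card_set] at this
  rw [L.support_of_mem hj hc, Finset.card_insert_of_notMem (by simpa using hc)]
  omega

/-- The weights `w + 1` and `n - w + 1` differ because `n ≠ 2w`, so the weight of a row reveals
whether its entries are conjugated after normalization. -/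
theorem lastBit_eq (hw : n ≠ 2 * w) {r : Fin p} {c : Fin n} {j : Fin k}
    (hj : (O r c).HasVar j) : lastBit O w r = if c ∈ L.set j then 1 else 0 := by
  rw [lastBit]
  by_cases hc : c ∈ L.set j
  · have := L.card_support_of_mem hj hc
    rw [if_pos hc, if_neg (by omega)]
  · rw [if_neg hc, if_pos (L.card_support_of_notMem hj hc)]

theorem phi_rowVec (hw : n ≠ 2 * w) {r : Fin p} {c : Fin n} {j : Fin k}
    (hj : (O r c).HasVar j) : phi (rowVec O w r) c = vec (L.set j) 0 := by
  rw [rowVec, L.lastBit_eq hw hj]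
  by_cases hc : c ∈ L.set j
  · rw [if_pos hc, phi_vec_one (mem_support.2 ⟨j, hj⟩), L.support_of_mem hj hc]
    congr 1
    ext x
    simp only [Finset.mem_insert, Finset.mem_compl]
    grind
  · rw [if_neg hc, phi_vec_zero (mem_support.2 ⟨j, hj⟩), L.support_of_notMem hj hc,
      Finset.erase_insert hc]

theorem mem_set_iff_of_mem (hw : n ≠ 2 * w) {r : Fin p} {c c' : Fin n} {i j : Fin k}
    (hi : (O r c).HasVar i) (hj : (O r c').HasVar j) : c ∈ L.set i ↔ c' ∈ L.set j := by
  have h1 := L.lastBit_eq hw hi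
  rw [L.lastBit_eq hw hj] at h1
  by_cases h2 : c ∈ L.set i <;> by_cases h3 : c' ∈ L.set j <;> simp [h2, h3] at h1 ⊢

/-- The four signs of the block multiply to `-1` in `O` by orthogonality and in `𝒢_n` by
`theta_sign`, so the four ratios multiply to `1`. -/
theorem exists_partner_of_notMem (h : IsDesign O) (hw : n ≠ 2 * w) {r : Fin p} {c c' : Fin n}
    {i j : Fin k} (hi : (O r c).HasVar i) (hj : (O r c').HasVar j) (hcc : c ≠ c')
    (hc : c ∉ L.set i) :
    ∃ r', (O r' c).HasVar j ∧ (O r' c').HasVar i ∧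
      ratio O w r c * ratio O w r c' = ratio O w r' c * ratio O w r' c' := by
  have hc' : c' ∈ L.set i := by
    have h1 := mem_support.2 ⟨j, hj⟩
    rw [L.support_of_notMem hi hc] at h1
    exact (Finset.mem_insert.1 h1).resolve_left (Ne.symm hcc)
  obtain ⟨s, b, e⟩ := hi
  obtain ⟨s', b', e'⟩ := hj
  obtain ⟨r', t, t', f, f', hs⟩ := h.exists_partner hcc e e'
  refine ⟨r', ⟨_, _, f⟩, ⟨_, _, f'⟩, ?_⟩
  have h1 : rowVec O w r = vec (support O r) 0 := by
    rw [rowVec, L.lastBit_eq hw ⟨_, _, e⟩, if_neg hc]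
  have h2 : rowVec O w r' = vec (support O r') 1 := by
    rw [rowVec, L.lastBit_eq hw ⟨_, _, f'⟩, if_pos hc']
  have h3 : support O r' = insert c (insert c' (support O r)ᶜ) := by
    rw [L.support_of_notMem ⟨_, _, e⟩ hc, L.support_of_mem ⟨_, _, f'⟩ hc']
    ext x
    simp only [Finset.mem_insert, Finset.mem_compl]
    grind
  have h4 := theta_sign (mem_support.2 ⟨i, _, _, e⟩) (mem_support.2 ⟨j, _, _, e'⟩) hcc h3
  simp only [ratio, e, e', f, f', h1, h2, Entry.sgn]
  generalize ((-1) ^ theta (vec (support O r) 0) c : ℤˣ) = x₁ at *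
  generalize ((-1) ^ theta (vec (support O r) 0) c' : ℤˣ) = x₂ at *
  generalize ((-1) ^ theta (vec (support O r') 1) c : ℤˣ) = x₃ at *
  generalize ((-1) ^ theta (vec (support O r') 1) c' : ℤˣ) = x₄ at *
  have h5 : s * x₁ * (s' * x₂) * (t * x₃ * (t' * x₄)) = 1 := by
    calc _ = s * s' * (t * t') * (x₁ * x₂ * (x₃ * x₄)) := by
          simp only [mul_comm, mul_left_comm]
      _ = 1 := by rw [hs, h4]; rfl
  rw [mul_eq_one_iff_eq_inv, Int.units_inv_eq_self] at h5
  exact h5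

theorem exists_partner (L : Layering O w) (h : IsDesign O) (hw : n ≠ 2 * w) {r : Fin p} {c c' : Fin n}
    {i j : Fin k} (hi : (O r c).HasVar i) (hj : (O r c').HasVar j) (hcc : c ≠ c') :
    ∃ r', (O r' c).HasVar j ∧ (O r' c').HasVar i ∧
      ratio O w r c * ratio O w r c' = ratio O w r' c * ratio O w r' c' := by
  by_cases hc : c ∈ L.set i
  · have hc' : c' ∉ L.set i := by
      have h1 := mem_support.2 ⟨j, hj⟩
      rw [L.support_of_mem hi hc] at h1
      simpa using (Finset.mem_insert.1 h1).resolve_left (Ne.symm hcc)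
    obtain ⟨s, b, e⟩ := id hi
    obtain ⟨s', b', e'⟩ := hj
    obtain ⟨r', t, t', f, f', -⟩ := h.exists_partner hcc e e'
    obtain ⟨r'', h1, h2, h3⟩ :=
      L.exists_partner_of_notMem h hw ⟨_, _, f'⟩ ⟨_, _, f⟩ (Ne.symm hcc) hc'
    rw [(h.existsUnique_row i c).unique h2 hi] at h3
    exact ⟨r', ⟨_, _, f⟩, ⟨_, _, f'⟩, by rw [mul_comm, ← h3, mul_comm]⟩
  · exact L.exists_partner_of_notMem h hw hi hj hcc hc

theorem set_eq_of_notMem (hw : n ≠ 2 * w) {r : Fin p} {a b : Fin n} {i j : Fin k}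
    (hi : (O r b).HasVar i) (hj : (O r a).HasVar j) (hab : a ≠ b) (hb : b ∉ L.set i) :
    a ∈ L.set i ∧ L.set j = insert b ((L.set i).erase a) := by
  have h1 := L.support_of_notMem hi hb
  have ha : a ∉ L.set j := by rwa [← L.mem_set_iff_of_mem hw hi hj]
  have h2 := L.support_of_notMem hj ha
  have h3 : a ∈ L.set i := by
    have := Finset.mem_insert_self a (L.set j)
    rw [← h2, h1] at this
    exact (Finset.mem_insert.1 this).resolve_left hab
  refine ⟨h3, ?_⟩
  rw [← Finset.erase_insert ha, ← h2, h1, Finset.erase_insert_of_ne hab.symm]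

/-- Two variables with signs, in a common row, whose signs differ by the relative sign of the two
entries in which they occur. -/
def Edge (O : Matrix (Fin p) (Fin n) (Entry (Fin k))) (w : ℕ) (x y : Fin k × ℤˣ) : Prop :=
  ∃ r c c', c ≠ c' ∧ (O r c).HasVar x.1 ∧ (O r c').HasVar y.1 ∧
    y.2 = x.2 * (ratio O w r c * ratio O w r c')

theorem Edge.symm {x y : Fin k × ℤˣ} (h : Edge O w x y) : Edge O w y x := by
  obtain ⟨r, c, c', hcc, hx, hy, e⟩ := h
  refine ⟨r, c', c, hcc.symm, hy, hx, ?_⟩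
  rw [e, mul_comm (ratio O w r c'), mul_assoc, Int.units_mul_self, mul_one]

/-- A row and its partner carry the same edge with the columns exchanged and the same relative sign;
one has last bit `0`, the other `1`. Having both lets later arguments choose the convenient row. -/
theorem edge_forms (h : IsDesign O) (hw : n ≠ 2 * w) {x y : Fin k × ℤˣ} (hxy : Edge O w x y) :
    ∃ a ∈ L.set x.1, ∃ b, b ∉ L.set x.1 ∧ L.set y.1 = insert b ((L.set x.1).erase a) ∧
      (∃ r, (O r b).HasVar x.1 ∧ (O r a).HasVar y.1 ∧
        y.2 = x.2 * (ratio O w r b * ratio O w r a)) ∧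
      ∃ r, (O r a).HasVar x.1 ∧ (O r b).HasVar y.1 ∧
        y.2 = x.2 * (ratio O w r a * ratio O w r b) := by
  obtain ⟨r, c, c', hcc, hx, hy, e⟩ := hxy
  obtain ⟨r', hy', hx', e'⟩ := L.exists_partner h hw hx hy hcc
  rw [e'] at e
  by_cases hc : c ∈ L.set x.1
  · have hc' : c' ∉ L.set x.1 := by
      have h1 := mem_support.2 ⟨_, hy⟩
      rw [L.support_of_mem hx hc] at h1
      simpa using (Finset.mem_insert.1 h1).resolve_left (Ne.symm hcc)
    obtain ⟨h1, h2⟩ := L.set_eq_of_notMem hw hx' hy' hcc hc'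
    exact ⟨c, h1, c', hc', h2, ⟨r', hx', hy', by rw [e, mul_comm (ratio O w r' c)]⟩,
      ⟨r, hx, hy, by rw [e, e']⟩⟩
  · obtain ⟨h1, h2⟩ := L.set_eq_of_notMem hw hx hy hcc.symm hc
    exact ⟨c', h1, c, hc, h2, ⟨r, hx, hy, by rw [e, e']⟩,
      ⟨r', hx', hy', by rw [e, mul_comm (ratio O w r' c)]⟩⟩

theorem edge_lift (h : IsDesign O) (hw : n ≠ 2 * w) (x : Fin k × ℤˣ) (Q : Finset (Fin n))
    (hQ : Exchange (L.set x.1) Q) : ∃ y, Edge O w x y ∧ L.set y.1 = Q := by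
  obtain ⟨a, ha, b, hb, rfl⟩ := hQ
  have hab : a ≠ b := fun h => hb (h ▸ ha)
  obtain ⟨r, hr, -⟩ := h.existsUnique_row x.1 b
  have h1 : a ∈ support O r := by
    rw [L.support_of_notMem hr hb]
    exact Finset.mem_insert_of_mem ha
  obtain ⟨j, hj⟩ := mem_support.1 h1
  exact ⟨(j, x.2 * (ratio O w r b * ratio O w r a)), ⟨r, b, a, hab.symm, hr, hj, rfl⟩,
    (L.set_eq_of_notMem hw hr hj hab hb).2⟩

theorem hasVar_unique {e : Entry (Fin k)} {i j : Fin k} (hi : e.HasVar i) (hj : e.HasVar j) :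
    i = j := by
  obtain ⟨s, b, rfl⟩ := hi
  obtain ⟨s', b', e'⟩ := hj
  exact (Entry.var.inj e').2.2

/-- Uniqueness of lifts: the second edge must undo the exchange of the first, so both are realized
in the row containing `y` in column `a`, and that row has one entry in column `b`. -/
theorem edge_back (h : IsDesign O) (hw : n ≠ 2 * w) (x y z : Fin k × ℤˣ)
    (hxy : Edge O w x y) (hyz : Edge O w y z) (hxz : L.set x.1 = L.set z.1) : x = z := by
  obtain ⟨a, ha, b, hb, hy, ⟨r, h1, h2, h3⟩, -⟩ := L.edge_forms h hw hxy
  obtain ⟨a', ha', b', hb', hz, ⟨r', h1', h2', h3'⟩, -⟩ := L.edge_forms h hw hyz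
  have hab : a' = b ∧ b' = a := by
    rw [← hxz] at hz
    constructor
    · have : a' ∉ L.set x.1 := by
        rw [hz]
        simp only [Finset.mem_insert, Finset.mem_erase]
        grind
      rw [hy] at ha'
      grind
    · have : b' ∈ L.set x.1 := by
        rw [hz]
        simp
      rw [hy] at hb'
      grind
  obtain ⟨rfl, rfl⟩ := hab
  have hr := (h.existsUnique_row y.1 b').unique h1' h2
  subst hr
  refine Prod.ext (hasVar_unique h1 h2') ?_
  rw [h3', h3, mul_comm (ratio O w r' b'), mul_assoc, Int.units_mul_self, mul_one]

/-- All three variables lie in a single row, along which the relative signs compose. -/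
theorem edge_triangle (h : IsDesign O) (hw : n ≠ 2 * w) (x y z : Fin k × ℤˣ)
    (hxy : Edge O w x y) (hyz : Edge O w y z) (hxz : Exchange (L.set x.1) (L.set z.1)) :
    Edge O w x z := by
  obtain ⟨a, ha, b, hb, hy, ⟨r, h1, h2, h3⟩, ⟨q, g1, g2, g3⟩⟩ := L.edge_forms h hw hxy
  obtain ⟨a', ha', b', hb', hz, ⟨r', h1', h2', h3'⟩, ⟨q', g1', g2', g3'⟩⟩ := L.edge_forms h hw hyz
  have hsign : ∀ u v t : ℤˣ, u * v * (v * t) = u * t := fun u v t => by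
    rw [mul_assoc, ← mul_assoc v, Int.units_mul_self, one_mul]
  -- If both exchanges cancelled, the end sets would coincide; if neither did, they would differ in
  -- two elements.
  have hcases : a' = b ∧ b' ≠ a ∨ b' = a ∧ a' ≠ b := by
    obtain ⟨a₁, ha₁, b₁, hb₁, e⟩ := hxz
    have hza : ∀ t, t ∈ L.set x.1 → t ∉ L.set z.1 → t = a₁ := by
      intro t h1 h2
      rw [e] at h2
      grind
    have hne : L.set z.1 ≠ L.set x.1 := by
      intro h
      rw [← h, e] at hb₁
      simp at hb₁
    by_cases h1 : a' = b
    · refine Or.inl ⟨h1, fun h2 => hne ?_⟩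
      rw [hz, hy, h1, h2]
      ext t
      simp only [Finset.mem_insert, Finset.mem_erase]
      grind
    · refine Or.inr ⟨?_, h1⟩
      by_contra h2
      rw [hy] at ha' hb' hz
      have h3 := hza a ha (by rw [hz]; grind)
      have h4 := hza a' (by grind) (by rw [hz]; grind)
      grind
  rcases hcases with ⟨rfl, hne⟩ | ⟨rfl, hne⟩
  · have hr := (h.existsUnique_row y.1 a').unique g1' g2
    subst hr
    refine ⟨q', a, b', hne.symm, g1, g2', ?_⟩
    rw [g3', g3, mul_assoc, hsign]
  · have hr := (h.existsUnique_row y.1 b').unique h1' h2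
    subst hr
    refine ⟨r', b, a', hne.symm, h1, h2', ?_⟩
    rw [h3', h3, mul_assoc, hsign]

end Layering

end Structure

/-! ### The section, the matching of rows, and the equivalence. -/

section Structure

variable {p n k : ℕ} {O : Matrix (Fin p) (Fin n) (Entry (Fin k))} {w : ℕ}

namespace Layering

variable (L : Layering O w)

/-- By `edge_back`, every neighbour of a point of the section lies on the section. The variables on
it are thus closed under sharing a row, and atomicity makes them all. -/
theorem exists_signs (h : IsDesign O) (ha : IsAtomic O) (hn : 0 < n) (hw : n ≠ 2 * w)
    (j₀ : Fin k) :
    Function.Injective L.set ∧ (∀ Q : Finset (Fin n), Q.card = w → ∃ j, L.set j = Q) ∧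
      ∃ ε : Fin k → ℤˣ, ∀ r c c' i j, (O r c).HasVar i → (O r c').HasVar j →
        ratio O w r c * ε i = ratio O w r c' * ε j := by
  obtain ⟨σ, hσ₀, hσ, hE⟩ := exists_johnson_section (fun x : Fin k × ℤˣ => L.set x.1) (Edge O w)
    (fun _ _ => Edge.symm) (L.edge_lift h hw) (L.edge_triangle h hw) (j₀, 1)
  simp only [L.card_set] at hσ₀ hσ hE
  have hstep : ∀ Q, Q.card = w → ∀ y, Edge O w (σ Q) y → y = σ (L.set y.1) := by
    intro Q hQ y hy
    obtain ⟨a, ha, b, hb, e, -⟩ := L.edge_forms h hw hy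
    refine L.edge_back h hw y (σ Q) _ hy.symm (hE Q _ hQ ?_) (hσ _ (L.card_set _)).symm
    rw [hσ Q hQ] at ha hb e
    exact ⟨a, ha, b, hb, e⟩
  obtain ⟨hall, -⟩ := ha.closed_eq_univ h hn (fun j => (σ (L.set j)).1 = j)
    ⟨j₀, by rw [hσ₀]⟩ (by
      intro r c c' i j hi hj e
      by_cases hcc : c = c'
      · subst hcc
        rw [← hasVar_unique hi hj]
        exact e
      · have := hstep (L.set i) (L.card_set i)
          (j, (σ (L.set i)).2 * (ratio O w r c * ratio O w r c'))
          ⟨r, c, c', hcc, by rwa [e], hj, rfl⟩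
        rw [← this])
  refine ⟨fun i j hij => ?_, fun Q hQ => ⟨_, hσ Q hQ⟩, fun j => (σ (L.set j)).2, ?_⟩
  · rw [← hall i, ← hall j, hij]
  · intro r c c' i j hi hj
    by_cases hcc : c = c'
    · subst hcc
      rw [hasVar_unique hi hj]
    · have := hstep (L.set i) (L.card_set i)
          (j, (σ (L.set i)).2 * (ratio O w r c * ratio O w r c'))
          ⟨r, c, c', hcc, by rwa [hall i], hj, rfl⟩
      dsimp only at this ⊢
      rw [← this, mul_comm (ratio O w r c'), mul_assoc, mul_assoc, Int.units_mul_self, mul_one,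
        mul_comm]

theorem rowVec_mem (L : Layering O w) (hw : n ≠ 2 * w) {r : Fin p} (hr : ∃ c j, (O r c).HasVar j) :
    (rowVec O w r (Fin.last n) = 0 ∧ (wt (rowVec O w r) : ℤ) = (w : ℤ) + 1) ∨
      (rowVec O w r (Fin.last n) = 1 ∧ (wt (rowVec O w r) : ℤ) = n - (w : ℤ) + 2) := by
  obtain ⟨c, j, hj⟩ := hr
  rw [rowVec, wt_vec, vec_last, L.lastBit_eq hw hj]
  by_cases hc : c ∈ L.set j
  · have := L.card_support_of_mem hj hc
    rw [if_pos hc]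
    refine Or.inr ⟨rfl, ?_⟩
    rw [ZMod.val_one]
    push_cast
    omega
  · rw [if_neg hc, L.card_support_of_notMem hj hc]
    exact Or.inl ⟨rfl, by simp⟩

/-- Rows with equal vectors contain, in any column of the support, variables with the same `w`-set,
hence the same variable, which occurs there only once. -/
theorem rowVec_injective (h : IsDesign O) (hw : n ≠ 2 * w)
    (hr : ∀ r, ∃ c j, (O r c).HasVar j) (hinj : Function.Injective L.set) :
    Function.Injective (rowVec O w) := by
  intro r r' e
  obtain ⟨c, j, hj⟩ := hr r
  have h1 : c ∈ support O r' := by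
    rw [← (vec_injective e).1]
    exact mem_support.2 ⟨j, hj⟩
  obtain ⟨j', hj'⟩ := mem_support.1 h1
  have h2 := L.phi_rowVec hw hj
  rw [e, L.phi_rowVec hw hj'] at h2
  have h3 := hinj (vec_injective h2).1
  subst h3
  exact (h.existsUnique_row j' c).unique hj hj'

theorem exists_rowVec_eq (h : IsDesign O) (hw : n ≠ 2 * w) (hwn : w ≤ n)
    (hsurj : ∀ Q : Finset (Fin n), Q.card = w → ∃ j, L.set j = Q) (α : GRow n w) :
    ∃ r, rowVec O w r = α.1 := by
  obtain ⟨α, hα⟩ := α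
  have hα' := vec_eta α
  set S : Finset (Fin n) := Finset.univ.filter fun i => α i.castSucc = 1
  have hwt := wt_vec S (α (Fin.last n))
  rw [hα'] at hwt
  rcases hα with ⟨h0, h1⟩ | ⟨h0, h1⟩
  · rw [h0] at hwt hα'
    rw [ZMod.val_zero] at hwt
    have hS : S.card = w + 1 := by omega
    obtain ⟨c, hc⟩ : S.Nonempty := by
      rw [← Finset.card_pos]
      omega
    -- The variable that `φ` assigns to column `c`; its row in that column has support `S`.
    obtain ⟨j, hj⟩ := hsurj (S.erase c) (by rw [Finset.card_erase_of_mem hc]; omega)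
    obtain ⟨r, hr, -⟩ := h.existsUnique_row j c
    have hcj : c ∉ L.set j := by simp [hj]
    refine ⟨r, ?_⟩
    rw [rowVec, L.lastBit_eq hw hr, if_neg hcj, L.support_of_notMem hr hcj, hj,
      Finset.insert_erase hc, hα']
  · rw [h0] at hwt hα'
    rw [ZMod.val_one] at hwt
    have hS : S.card + w = n + 1 := by omega
    obtain ⟨c, hc⟩ : S.Nonempty := by
      rw [← Finset.card_pos]
      omega
    obtain ⟨j, hj⟩ := hsurj (insert c Sᶜ) (by
      have := Finset.card_add_card_compl S
      rw [Fintype.card_fin] at this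
      rw [Finset.card_insert_of_notMem (by simpa using hc)]
      omega)
    obtain ⟨r, hr, -⟩ := h.existsUnique_row j c
    have hcj : c ∈ L.set j := by simp [hj]
    refine ⟨r, ?_⟩
    rw [rowVec, L.lastBit_eq hw hr, if_pos hcj, L.support_of_mem hr hcj, hj]
    refine Eq.trans ?_ hα'
    congr 1
    ext x
    simp only [Finset.mem_insert, Finset.mem_compl]
    grind

theorem onEntry_rowVec (hw : n ≠ 2 * w) {ε : Fin k → ℤˣ}
    (hε : ∀ r c c' i j, (O r c).HasVar i → (O r c').HasVar j →
        ratio O w r c * ε i = ratio O w r c' * ε j)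
    {r : Fin p} {c₀ : Fin n} {j₀ : Fin k} (hj₀ : (O r c₀).HasVar j₀)
    (T : Operations (Fin p) (GRow n w) (Fin n) (Fin k) (Vec n))
    (hcol : ∀ c, T.colNeg c = 1) (hren : ∀ j, T.rename j = vec (L.set j) 0)
    (hconj : T.instConj = L.conj) (hneg : T.instNeg = ε)
    (hrow : T.rowNeg r = ratio O w r c₀ * ε j₀) (c : Fin n) :
    bigG n (rowVec O w r) c = T.onEntry r c (O r c) := by
  cases e : O r c with
  | zero => exact bigG_vec_of_notMem (by simp [support, e])
  | var s b j =>
    have hj : (O r c).HasVar j := ⟨s, b, e⟩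
    -- The ratio times `ε` is constant along the row, so its value at the reference entry `c₀`
    -- serves as row negation for every column.
    have hsign : ratio O w r c₀ * ε j₀ * 1 * ε j * s = (-1) ^ theta (rowVec O w r) c := by
      rw [hε r c₀ c j₀ j hj₀ hj, mul_one, mul_assoc (ratio O w r c), Int.units_mul_self, mul_one,
        ratio, e, Entry.sgn, mul_right_comm, Int.units_mul_self, one_mul]
    rw [rowVec, bigG_vec_of_mem (mem_support.2 ⟨j, hj⟩), ← rowVec, L.phi_rowVec hw hj,
      Operations.onEntry, hcol, hren, hconj, hneg, hrow, hsign, L.conj_eq r c s b j e,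
      L.lastBit_eq hw hj]
    congr 1
    by_cases hc : c ∈ L.set j <;> simp [hc]

end Layering

theorem classification_of_nonneg (hn : 0 < n) (h : IsDesign O) (hf : IsFirstType O)
    (ha : IsAtomic O) {r₀ : Fin p} (hr₀ : rowWeight O r₀ = w + 1) (hw : n ≠ 2 * w) :
    p = binom n ((w : ℤ) - 1) + binom n ((w : ℤ) + 1) ∧ k = binom n (w : ℤ) ∧
      ∃ T : Operations (Fin p) (GRow n w) (Fin n) (Fin k) (Vec n),
        (∀ c, T.colNeg c = 1) ∧ T.Transforms O (G n w) := by
  obtain ⟨⟨L⟩, hrows⟩ := exists_layering h hf ha hn hr₀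
  have hrows' := hrows
  choose c₀ j₀ hj₀ using hrows'
  obtain ⟨hinj, hsurj, ε, hε⟩ := L.exists_signs h ha hn hw (j₀ r₀)
  have hwn := L.le (j₀ r₀)
  let e : Fin p ≃ GRow n w := Equiv.ofBijective
    (fun r => ⟨rowVec O w r, L.rowVec_mem hw (hrows r)⟩)
    ⟨fun r r' hr => L.rowVec_injective h hw hrows hinj (congrArg Subtype.val hr),
      fun α => by
        obtain ⟨r, hr⟩ := L.exists_rowVec_eq h hw hwn hsurj α
        exact ⟨r, Subtype.ext hr⟩⟩
  refine ⟨?_, ?_, ?_⟩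
  · rw [← card_GRow (w : ℤ) (by omega) (by exact_mod_cast hwn), ← Fintype.card_congr e,
      Fintype.card_fin]
  · change k = n.choose w
    conv_rhs => rw [← Fintype.card_fin n, ← Finset.card_univ, ← Finset.card_powersetCard]
    conv_lhs => rw [← Fintype.card_fin k, ← Finset.card_univ]
    refine Finset.card_bij (fun j _ => L.set j) ?_ ?_ ?_
    · intro j _
      simp [Finset.mem_powersetCard, L.card_set]
    · intro i _ j _ hij
      exact hinj hij
    · intro Q hQ
      obtain ⟨j, hj⟩ := hsurj Q (Finset.mem_powersetCard.1 hQ).2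
      exact ⟨j, Finset.mem_univ _, hj⟩
  · refine ⟨⟨e, Equiv.refl _, ⟨fun j => vec (L.set j) 0, fun i j hij =>
      hinj (vec_injective hij).1⟩, L.conj, ε, fun r => ratio O w r (c₀ r) * ε (j₀ r),
      fun _ => 1⟩, fun _ => rfl, fun r c => ?_⟩
    exact L.onEntry_rowVec hw hε (hj₀ r) _ (fun _ => rfl) (fun _ => rfl) rfl rfl rfl c

/-- An atomic design with a zero row consists of that row. -/
theorem classification_of_zero_row (hn : 0 < n) (h : IsDesign O) (ha : IsAtomic O) {r₀ : Fin p}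
    (hr₀ : rowWeight O r₀ = 0) :
    p = binom n (-1 - 1) + binom n (-1 + 1) ∧ k = binom n (-1) ∧
      ∃ T : Operations (Fin p) (GRow n (-1)) (Fin n) (Fin k) (Vec n),
        (∀ c, T.colNeg c = 1) ∧ T.Transforms O (G n (-1)) := by
  have hzero : ∀ c, O r₀ c = .zero := by
    intro c
    by_contra hc
    have h1 : c ∈ support O r₀ := by simp [support, hc]
    rw [Finset.card_eq_zero.1 (show (support O r₀).card = 0 from hr₀)] at h1
    simp at h1
  have hR : ({r₀} : Finset (Fin p)) = Finset.univ := by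
    by_contra hne
    -- A zero row is by itself a design with no variables.
    refine ha {r₀} (Finset.singleton_nonempty _) hne ⟨∅, ?_, ?_⟩
    · rintro ⟨r, hr⟩ c s b i e
      rw [Finset.mem_singleton] at hr
      subst hr
      simp [hzero] at e
    · intro z
      ext c c'
      rw [Matrix.mul_apply]
      rw [Finset.sum_eq_zero]
      · simp
      · rintro ⟨r, hr⟩ -
        rw [Finset.mem_singleton] at hr
        subst hr
        simp [hzero, Entry.eval]
  have hr : ∀ r, r = r₀ := fun r => by
    rw [← Finset.mem_singleton, hR]
    exact Finset.mem_univ r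
  have hp : p = 1 := by
    rw [← Fintype.card_fin p, ← Finset.card_univ, ← hR, Finset.card_singleton]
  have hk : IsEmpty (Fin k) := ⟨fun j => by
    obtain ⟨r, ⟨s, b, e⟩, -⟩ := h.existsUnique_row j ⟨0, hn⟩
    rw [hr r, hzero] at e
    cases e⟩
  have hp' : p = binom n (-1 - 1) + binom n (-1 + 1) := by
    rw [hp]
    change 1 = 0 + n.choose 0
    simp
  refine ⟨hp', ?_, ?_⟩
  · rw [← Fintype.card_fin k, Fintype.card_eq_zero]
    rfl
  · have e : Fin p ≃ GRow n (-1) := Fintype.equivOfCardEq (by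
      rw [card_GRow (-1) le_rfl (by omega), Fintype.card_fin, ← hp'])
    refine ⟨⟨e, Equiv.refl _, ⟨isEmptyElim, fun i => isEmptyElim i⟩, isEmptyElim, isEmptyElim,
      fun _ => 1, fun _ => 1⟩, fun _ => rfl, fun r c => ?_⟩
    rw [hr r, hzero]
    change bigG n (e r₀).1 c = .zero
    obtain ⟨α, hα⟩ := e r₀
    have hα' := vec_eta α
    set S : Finset (Fin n) := Finset.univ.filter fun i => α i.castSucc = 1
    have hwt := wt_vec S (α (Fin.last n))
    rw [hα'] at hwt
    have hle : S.card ≤ n := by simpa using Finset.card_le_univ S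
    -- With `w = -1`, last bit `1` would require weight `n + 3`, more than the number of
    -- coordinates.
    have hS : S.card = 0 := by
      rcases hα with ⟨h0, h1⟩ | ⟨h0, h1⟩
      · omega
      · rw [h0, ZMod.val_one] at hwt
        omega
    change bigG n α c = .zero
    rw [← hα']
    exact bigG_vec_of_notMem (by rw [Finset.card_eq_zero.1 hS]; simp)

end Structure

end COD

theorem mainTheorem2 {p n k : ℕ} (hn : 0 < n) (w : ℤ)
    (O : Matrix (Fin p) (Fin n) (COD.Entry (Fin k)))
    (hO : COD.IsDesign O) (hfirst : COD.IsFirstType O) (hatomic : COD.IsAtomic O)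
    (hrow : ∃ r : Fin p, (COD.rowWeight O r : ℤ) = w + 1)
    (hw : (n : ℤ) ≠ 2 * w) :
    p = COD.binom n (w - 1) + COD.binom n (w + 1) ∧
    k = COD.binom n w ∧
    ∃ T : COD.Operations (Fin p) (COD.GRow n w) (Fin n) (Fin k) (COD.Vec n),
      (∀ c, T.colNeg c = 1) ∧ T.Transforms O (COD.G n w) := by
  obtain ⟨r₀, hr₀⟩ := hrow
  rcases lt_or_ge w 0 with h | h
  · obtain rfl : w = -1 := by omega
    exact COD.classification_of_zero_row hn hO hatomic (r₀ := r₀) (by omega)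
  · obtain ⟨m, rfl⟩ := Int.eq_ofNat_of_zero_le h
    exact COD.classification_of_nonneg hn hO hfirst hatomic (r₀ := r₀) (by omega) (by omega)
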